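/- A 2-tangle is an unoriented tangle with four fixed ends (two upper, two lower; closed components allowed), given by a diagram, and considered up to isotopy fixing the ends, i.e. up to planar isotopy and the Reidemeister moves. A $5$-move replaces two parallel strands by a twist of five crossings ($\pm 5$ half twists); two tangles are $5$-move equivalent if they are related by a finite sequence of isotopies, $5$-moves and inverse $5$-moves. Let $[0]$ be the tangle of two horizontal arcs, $[\frac10]=[\infty]$ the tangle of two vertical strands, and $[1]$ (resp. $[-1]$) the tangle with a single crossing whose overstrand has positive (resp. negative) slope. Write $S+T$ for placing $S$ to the left of $T$ and joining the adjacent ends, and $S/T$ for stacking $S$ on top of $T$ and joining the adjacent ends. A tangle is rational if it is isotopic to one obtained from $[0]$ or $[\frac10]$ by adding crossings $[\pm1]$ one at a time on the right, left, top or bottom. In Conway's notation, $[\pm2]=[\pm1]+[\pm1]$, $[\pm\frac12]=[\pm1]/[\pm1]$, $[\pm\frac32]=[\pm1]+[\pm\frac12]$ (equal signs throughout), $[\frac52]=[2]+[\frac12]$ and $[\frac25]=[\frac12]/[2]$. **Lemma.** Every rational tangle is $5$-move equivalent to one of the twelve 2-tangles $$[\tfrac10],\ [0],\ [-1],\ [1],\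 [-2],\ [2],\ [\tfrac25],\ [\tfrac52],\ [\tfrac32],\ [-\tfrac32],\ [\tfrac12],\ [-\tfrac12].$$ Furthermore, these twelve tangles lie in pairwise distinct $5$-move equivalence classes. -/

import Mathlib

/-! Unoriented tangle diagrams in a strip, cut by horizontal lines into elementary slices, up to
planar isotopy and the Reidemeister moves. -/

namespace TangleDiagram

/-- The elementary pieces of a diagram. `cap` is a local maximum `∩`, `cup` a local minimum `∪`.
In the crossing `pos` the overstrand has positive slope (it joins the upper right to the lower
left end), in the crossing `neg` it has negative slope. -/
inductive Piece
  | cap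
  | cup
  | pos
  | neg
  deriving DecidableEq

/-- The number of strands that enter a piece from above. -/
def Piece.dom : Piece → ℕ
  | .cap => 0
  | .cup => 2
  | .pos => 2
  | .neg => 2

/-- The number of strands that leave a piece below. -/
def Piece.cod : Piece → ℕ
  | .cap => 2
  | .cup => 0
  | .pos => 2
  | .neg => 2

/-- A stack of slices, read from top to bottom. The slice `(i, g)` consists of `i` vertical
strands, then the piece `g`, then vertical strands up to the total width. -/
abbrev Word := List (ℕ × Piece)

/-- `Typed w n m`: the word `w` is the diagram of a tangle with `n` upper and `m` lower ends. -/
def Typed : Word → ℕ → ℕ → Prop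
  | [], n, m => n = m
  | (i, g) :: w, n, m => i + g.dom ≤ n ∧ Typed w (n - g.dom + g.cod) m

/-- Put `k` vertical strands to the left of a diagram. -/
def shift (k : ℕ) (w : Word) : Word := w.map fun s => (k + s.1, s.2)

theorem Typed.append {u v : Word} {n m l : ℕ} (hu : Typed u n m) (hv : Typed v m l) :
    Typed (u ++ v) n l := by
  induction u generalizing n with
  | nil => cases hu; exact hv
  | cons s u ih => exact ⟨hu.1, ih hu.2⟩

theorem Typed.add_right {w : Word} {n m : ℕ} (h : Typed w n m) (k : ℕ) :
    Typed w (n + k) (m + k) := by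
  induction w generalizing n with
  | nil => exact congrArg (· + k) h
  | cons s w ih =>
    obtain ⟨h1, h2⟩ := h
    refine ⟨by omega, ?_⟩
    have := ih h2
    rwa [show n - s.2.dom + s.2.cod + k = n + k - s.2.dom + s.2.cod by omega] at this

theorem Typed.shift {w : Word} {n m : ℕ} (h : Typed w n m) (k : ℕ) :
    Typed (shift k w) (k + n) (k + m) := by
  induction w generalizing n with
  | nil => exact congrArg (k + ·) h
  | cons s w ih =>
    obtain ⟨h1, h2⟩ := h
    refine ⟨?_, ?_⟩
    · show k + s.1 + s.2.dom ≤ k + n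
      omega
    · have := ih h2
      rwa [show k + (n - s.2.dom + s.2.cod) = k + n - s.2.dom + s.2.cod by omega] at this

/-- The local moves that generate isotopy of tangle diagrams with fixed ends. -/
inductive LocalIsotopy : Word → Word → Prop
  /-- Planar isotopy: pieces that lie side by side can change their heights. -/
  | exchange (i k : ℕ) (g h : Piece) :
      LocalIsotopy [(i, g), (i + g.cod + k, h)] [(i + g.dom + k, h), (i, g)]
  /-- Planar isotopy: a maximum cancels against an adjacent minimum. -/
  | zigzag_right (i : ℕ) : LocalIsotopy [(i, .cap), (i + 1, .cup)] []
  | zigzag_left (i : ℕ) : LocalIsotopy [(i + 1, .cap), (i, .cup)] []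
  /-- Planar isotopy: a crossing is turned around a maximum or a minimum. -/
  | slide_cap_pos (i : ℕ) :
      LocalIsotopy [(i, .cap), (i + 1, .pos)] [(i + 1, .cap), (i, .neg)]
  | slide_cap_neg (i : ℕ) :
      LocalIsotopy [(i, .cap), (i + 1, .neg)] [(i + 1, .cap), (i, .pos)]
  | slide_cup_pos (i : ℕ) :
      LocalIsotopy [(i + 1, .pos), (i, .cup)] [(i, .neg), (i + 1, .cup)]
  | slide_cup_neg (i : ℕ) :
      LocalIsotopy [(i + 1, .neg), (i, .cup)] [(i, .pos), (i + 1, .cup)]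
  /-- First Reidemeister move. -/
  | r1_cap_pos (i : ℕ) : LocalIsotopy [(i, .cap), (i, .pos)] [(i, .cap)]
  | r1_cap_neg (i : ℕ) : LocalIsotopy [(i, .cap), (i, .neg)] [(i, .cap)]
  | r1_cup_pos (i : ℕ) : LocalIsotopy [(i, .pos), (i, .cup)] [(i, .cup)]
  | r1_cup_neg (i : ℕ) : LocalIsotopy [(i, .neg), (i, .cup)] [(i, .cup)]
  /-- Second Reidemeister move. -/
  | r2_pos_neg (i : ℕ) : LocalIsotopy [(i, .pos), (i, .neg)] []
  | r2_neg_pos (i : ℕ) : LocalIsotopy [(i, .neg), (i, .pos)] []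
  /-- Third Reidemeister move. -/
  | r3 (i : ℕ) :
      LocalIsotopy [(i, .pos), (i + 1, .pos), (i, .pos)] [(i + 1, .pos), (i, .pos), (i + 1, .pos)]

/-- The `±5`-move: two parallel strands are replaced by five half twists of either handedness.
(A pair of parallel arcs in any other position is made vertical by a planar isotopy.) -/
inductive LocalFiveMove : Word → Word → Prop
  | pos (i : ℕ) : LocalFiveMove [] (List.replicate 5 (i, .pos))
  | neg (i : ℕ) : LocalFiveMove [] (List.replicate 5 (i, .neg))

/-- Replacement of one part of a diagram according to a local rule. -/
def InContext (R : Word → Word → Prop) (w w' : Word) : Prop :=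
  ∃ u v a b : Word, R a b ∧ w = u ++ a ++ v ∧ w' = u ++ b ++ v

end TangleDiagram

open TangleDiagram

/-- Diagrams of tangles with `n` upper and `m` lower ends. Closed components are allowed. -/
def Tangle (n m : ℕ) : Type := {w : Word // Typed w n m}

namespace Tangle

/-- Isotopy of tangles, with fixed ends. -/
def Isotopic {n m : ℕ} : Tangle n m → Tangle n m → Prop :=
  Relation.EqvGen fun S T => InContext LocalIsotopy S.1 T.1

/-- `5`-move equivalence of tangles: a finite sequence of isotopies, `±5`-moves and their
inverses. -/
def FiveMoveEquiv {n m : ℕ} : Tangle n m → Tangle n m → Prop :=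
  Relation.EqvGen fun S T => InContext LocalIsotopy S.1 T.1 ∨ InContext LocalFiveMove S.1 T.1

/-- The tangle `[∞] = [1/0]`, two vertical strands. -/
def infty : Tangle 2 2 := ⟨[], rfl⟩

/-- The tangle `[0]`, two horizontal arcs. -/
def zero : Tangle 2 2 := ⟨[(0, .cup), (0, .cap)], by simp [Typed, Piece.dom, Piece.cod]⟩

/-- The tangle `[1]`. -/
def one : Tangle 2 2 := ⟨[(0, .pos)], by simp [Typed, Piece.dom, Piece.cod]⟩

/-- The tangle `[-1]`. -/
def negOne : Tangle 2 2 := ⟨[(0, .neg)], by simp [Typed, Piece.dom, Piece.cod]⟩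

/-- Vertical composition: `S` on top of `T`. -/
def stack (S T : Tangle 2 2) : Tangle 2 2 := ⟨S.1 ++ T.1, S.2.append T.2⟩

/-- Horizontal composition: `S` to the left of `T`, the right ends of `S` joined to the
left ends of `T`. -/
def beside (S T : Tangle 2 2) : Tangle 2 2 :=
  ⟨(1, .cap) :: (S.1 ++ shift 2 T.1 ++ [(1, .cup)]),
    by simp [Piece.dom],
    ((S.2.add_right 2).append (T.2.shift 2)).append
      (by simp [Typed, Piece.dom, Piece.cod])⟩

/-- Diagrams built from `[0]` or `[∞]` by twisting adjacent ends, that is, by adding crossings one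
at a time on the right, on the left, at the top or at the bottom. -/
inductive RationalDiagram : Tangle 2 2 → Prop
  | zero : RationalDiagram zero
  | infty : RationalDiagram infty
  | right {T c : Tangle 2 2} (hT : RationalDiagram T) (hc : c = one ∨ c = negOne) :
      RationalDiagram (T.beside c)
  | left {T c : Tangle 2 2} (hT : RationalDiagram T) (hc : c = one ∨ c = negOne) :
      RationalDiagram (c.beside T)
  | bottom {T c : Tangle 2 2} (hT : RationalDiagram T) (hc : c = one ∨ c = negOne) :
      RationalDiagram (T.stack c)
  | top {T c : Tangle 2 2} (hT : RationalDiagram T) (hc : c = one ∨ c = negOne) :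
      RationalDiagram (c.stack T)

/-- A rational tangle is a 2-tangle isotopic to one with a rational diagram. -/
def IsRational (T : Tangle 2 2) : Prop := ∃ D, RationalDiagram D ∧ Isotopic T D

/-- The tangle `[2]`. -/
def two : Tangle 2 2 := one.beside one

/-- The tangle `[-2]`. -/
def negTwo : Tangle 2 2 := negOne.beside negOne

/-- The tangle `[1/2]`. -/
def half : Tangle 2 2 := one.stack one

/-- The tangle `[-1/2]`. -/
def negHalf : Tangle 2 2 := negOne.stack negOne

/-- The tangle `[3/2] = [1 + 1/2]`. -/
def threeHalves : Tangle 2 2 := one.beside half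

/-- The tangle `[-3/2] = [-1 - 1/2]`. -/
def negThreeHalves : Tangle 2 2 := negOne.beside negHalf

/-- The tangle `[5/2] = [2 + 1/2]`. -/
def fiveHalves : Tangle 2 2 := two.beside half

/-- The tangle `[2/5] = [1 / (2 + 1/2)]`; stacking adds the reciprocals of the fractions. -/
def twoFifths : Tangle 2 2 := half.stack two

/-- The twelve basic tangles `[1/0], [0], [-1], [1], [-2], [2], [2/5], [5/2], [3/2], [-3/2],
[1/2], [-1/2]`. -/
def basic : Fin 12 → Tangle 2 2 :=
  ![infty, zero, negOne, one, negTwo, two, twoFifths, fiveHalves, threeHalves, negThreeHalves,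
    half, negHalf]

end Tangle

/-!
Once an upper end of a 2-tangle is turned down, twists on the right and at the bottom are the two
standard generators of the three-strand braid group, acting on the three lower ends, and the
`5`-move makes their fifth powers trivial. The relations `a ^ 5 = b ^ 5 = 1` and `a b a = b a b`,
with the effect of the twists on `[0]` and `[∞]`, suffice to compute that the orbit has the twelve
basic tangles as its points. A twist on the left commutes with the twist on the right and satisfies
the same relations; hence the two agree on the orbit, and so do the twists at the top and at the
bottom.

The twelve classes are distinguished by their fractions modulo five: at an eighth root of unity
`A`, the Kauffman bracket of a rational tangle with fraction `p / q` is a suitably normalized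
combination `p [∞] - q [0]`, up to powers of `A`, and in characteristic five a `5`-move does not
change it.
-/

/-! ### Twists modulo five -/

/-- Elements of order dividing five that satisfy the braid relation, that is, a representation of
the quotient of the three-strand braid group in which fifth powers of generators are trivial. -/
structure FiveBraidPair {G : Type*} [Monoid G] (g h : G) : Prop where
  fst_pow : g ^ 5 = 1
  snd_pow : h ^ 5 = 1
  braid : g * h * g = h * g * h

namespace FiveBraidPair

theorem symm {G : Type*} [Monoid G] {g h : G} (H : FiveBraidPair g h) : FiveBraidPair h g :=
  ⟨H.snd_pow, H.fst_pow, H.braid.symm⟩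

theorem inv {G : Type*} [Group G] {g h : G} (H : FiveBraidPair g h) :
    FiveBraidPair g⁻¹ h⁻¹ where
  fst_pow := by rw [inv_pow, H.fst_pow, inv_one]
  snd_pow := by rw [inv_pow, H.snd_pow, inv_one]
  braid := by simpa only [mul_inv_rev, mul_assoc] using congrArg (·⁻¹) H.braid

theorem of_injective {X Y : Type*} {g h : Equiv.Perm X} {g' h' : Equiv.Perm Y}
    (H : FiveBraidPair g' h') {f : X → Y} (hf : Function.Injective f)
    (hg : Function.Semiconj f g g') (hh : Function.Semiconj f h h') : FiveBraidPair g h where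
  fst_pow := Equiv.ext fun x => hf <| by
    simpa [pow_succ, hg.eq] using Equiv.congr_fun H.fst_pow (f x)
  snd_pow := Equiv.ext fun x => hf <| by
    simpa [pow_succ, hh.eq] using Equiv.congr_fun H.snd_pow (f x)
  braid := Equiv.ext fun x => hf <| by
    simpa [hg.eq, hh.eq] using Equiv.congr_fun H.braid (f x)

end FiveBraidPair

/-- Permutations `a` and `b` that behave like the addition of `1` to a fraction and to its
reciprocal, modulo five, with `z` and `w` in the place of the fractions `0` and `1 / 0`. -/
structure TwistPair {X : Type*} (a b : Equiv.Perm X) (z w : X) : Prop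
    extends FiveBraidPair a⁻¹ b where
  fst_infty : a w = w
  snd_zero : b z = z
  one_eq : b w = a z
  negOne_eq : b⁻¹ w = a⁻¹ z

/-- The points that correspond to the fractions of `Tangle.basic`, in the same order. -/
def twistOrbit {X : Type*} (a b : Equiv.Perm X) (z w : X) : Fin 12 → X :=
  ![w, z, a⁻¹ z, a z, a⁻¹ (a⁻¹ z), a (a z), b (b (a (a z))), a (a (b (b w))), a (b (b w)),
    a⁻¹ (b⁻¹ (b⁻¹ w)), b (b w), b⁻¹ (b⁻¹ w)]

namespace TwistPair

variable {X : Type*} {a b c : Equiv.Perm X} {z w : X}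

/-- The symmetry `x ↦ 1 / x` of fractions. -/
theorem symm (h : TwistPair a b z w) : TwistPair b a w z where
  toFiveBraidPair := by simpa only [inv_inv] using h.toFiveBraidPair.symm.inv
  fst_infty := h.snd_zero
  snd_zero := h.fst_infty
  one_eq := h.one_eq.symm
  negOne_eq := h.negOne_eq.symm

/-- The symmetry `x ↦ -x` of fractions. -/
theorem mirror (h : TwistPair a b z w) : TwistPair a⁻¹ b⁻¹ z w where
  toFiveBraidPair := h.toFiveBraidPair.inv
  fst_infty := Equiv.Perm.inv_eq_iff_eq.2 h.fst_infty.symm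
  snd_zero := Equiv.Perm.inv_eq_iff_eq.2 h.snd_zero.symm
  one_eq := h.negOne_eq
  negOne_eq := by simpa only [inv_inv] using h.one_eq

theorem snd_snd_snd (h : TwistPair a b z w) (x : X) : b (b (b x)) = b⁻¹ (b⁻¹ x) := by
  rw [Equiv.Perm.eq_inv_iff_eq, Equiv.Perm.eq_inv_iff_eq]
  exact Equiv.congr_fun h.snd_pow x

theorem fst_conj (h : TwistPair a b z w) (x : X) : b (a (b⁻¹ x)) = a (b⁻¹ (a⁻¹ x)) := by
  have hconj : b * a * b⁻¹ = a * b⁻¹ * a⁻¹ := inv_injective <|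
    calc (b * a * b⁻¹)⁻¹ = a * (a⁻¹ * b * a⁻¹) * b⁻¹ := by group
      _ = (a * b⁻¹ * a⁻¹)⁻¹ := by rw [h.braid]; group
  exact Equiv.congr_fun hconj x

theorem fst_negHalf (h : TwistPair a b z w) : a (b⁻¹ (b⁻¹ w)) = b (b w) := by
  rw [h.negOne_eq, ← h.fst_conj, h.mirror.snd_zero, h.one_eq]

theorem snd_two (h : TwistPair a b z w) : b (a (a z)) = a (b (b w)) :=
  calc b (a (a z)) = b (a (b⁻¹ (b (b w)))) := by
        rw [Equiv.Perm.coe_inv, Equiv.symm_apply_apply, h.one_eq]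
    _ = a (b⁻¹ (b⁻¹ (b⁻¹ w))) := by
      rw [h.fst_conj, ← h.fst_negHalf, Equiv.Perm.coe_inv a, Equiv.symm_apply_apply]
    _ = a (b (b w)) := by rw [h.mirror.snd_snd_snd, inv_inv]

/-- This is `2/5 ≡ -2/5` modulo five. -/
theorem twoFifths_eq (h : TwistPair a b z w) :
    b (b (a (a z))) = b⁻¹ (b⁻¹ (a⁻¹ (a⁻¹ z))) := by
  rw [← h.symm.fst_negHalf, h.snd_snd_snd]

theorem fst_twoFifths (h : TwistPair a b z w) : a (b (b (a (a z)))) = b (b (a (a z))) :=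
  calc a (b (b (a (a z)))) = a (b⁻¹ (a⁻¹ (b⁻¹ (b⁻¹ w)))) := by
        rw [h.twoFifths_eq, h.mirror.snd_two]
    _ = b (a (b (b w))) := by
      rw [← h.fst_conj, h.mirror.snd_snd_snd, inv_inv]
    _ = b (b (a (a z))) := by rw [h.snd_two]

theorem fst_fiveHalves (h : TwistPair a b z w) :
    a (a (a (b (b w)))) = a⁻¹ (b⁻¹ (b⁻¹ w)) := by
  rw [h.symm.snd_snd_snd, ← h.fst_negHalf, Equiv.Perm.coe_inv a, Equiv.symm_apply_apply]

theorem fst_twistOrbit (h : TwistPair a b z w) (i : Fin 12) :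
    a (twistOrbit a b z w i) =
      twistOrbit a b z w (![0, 3, 1, 5, 2, 4, 6, 9, 7, 11, 8, 10] i) := by
  fin_cases i
  exacts [h.fst_infty, rfl, a.apply_symm_apply _, rfl, a.apply_symm_apply _, h.symm.snd_snd_snd z,
    h.fst_twoFifths, h.fst_fiveHalves, rfl, a.apply_symm_apply _, rfl, h.fst_negHalf]

theorem twistOrbit_symm (h : TwistPair a b z w) (i : Fin 12) :
    twistOrbit b a w z i = twistOrbit a b z w (![1, 0, 2, 3, 11, 10, 7, 6, 8, 9, 5, 4] i) := by
  fin_cases i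
  exacts [rfl, rfl, h.negOne_eq, h.one_eq, rfl, rfl, rfl, rfl, h.snd_two, h.mirror.snd_two, rfl,
    rfl]

theorem range_twistOrbit_symm (h : TwistPair a b z w) :
    Set.range (twistOrbit b a w z) = Set.range (twistOrbit a b z w) :=
  (Set.range_subset_iff.2 fun i => h.twistOrbit_symm i ▸ Set.mem_range_self _).antisymm
    (Set.range_subset_iff.2 fun i => h.symm.twistOrbit_symm i ▸ Set.mem_range_self _)

theorem mapsTo_fst (h : TwistPair a b z w) :
    Set.MapsTo a (Set.range (twistOrbit a b z w)) (Set.range (twistOrbit a b z w)) := by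
  rintro _ ⟨i, rfl⟩
  exact ⟨_, (h.fst_twistOrbit i).symm⟩

/-- Modulo five, every point is obtained from `0`, `1/2`, `2/5` or `1/0` by adding integers. Hence
two additions of `1` that commute agree on all points if they agree on these. -/
theorem eqOn_fst (h : TwistPair a b z w) (h' : TwistPair c b z w) (hac : Commute a c) :
    Set.EqOn c a (Set.range (twistOrbit a b z w)) := by
  have comm (x : X) : c (a x) = a (c x) := Equiv.congr_fun hac.symm.eq x
  have fwd {x : X} (hx : c x = a x) : c (a x) = a (a x) := by rw [comm, hx]
  have bwd {x : X} (hx : c x = a x) : c (a⁻¹ x) = a (a⁻¹ x) :=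
    a.injective (by rw [← comm, Equiv.Perm.coe_inv, Equiv.apply_symm_apply, hx])
  have zero : c z = a z := by rw [← h'.one_eq, h.one_eq]
  have two : c (c z) = a (a z) := by rw [zero, fwd zero]
  have half : c (b (b w)) = a (b (b w)) := by rw [← h'.snd_two, two, h.snd_two]
  have negHalf : c (b⁻¹ (b⁻¹ w)) = a (b⁻¹ (b⁻¹ w)) := by rw [h'.fst_negHalf, h.fst_negHalf]
  have twoFifths : c (b (b (a (a z)))) = a (b (b (a (a z)))) := by
    rw [h.fst_twoFifths, ← two, h'.fst_twoFifths]
  rintro _ ⟨i, rfl⟩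
  fin_cases i
  exacts [h'.fst_infty.trans h.fst_infty.symm, zero, bwd zero, fwd zero, bwd (bwd zero),
    fwd (fwd zero), twoFifths, fwd (fwd half), fwd half, bwd negHalf, half, negHalf]

theorem eqOn_snd (h : TwistPair a b z w) (h' : TwistPair a c z w) (hbc : Commute b c) :
    Set.EqOn c b (Set.range (twistOrbit a b z w)) :=
  h.range_twistOrbit_symm ▸ h.symm.eqOn_fst h'.symm hbc

theorem mapsTo_snd (h : TwistPair a b z w) :
    Set.MapsTo b (Set.range (twistOrbit a b z w)) (Set.range (twistOrbit a b z w)) :=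
  h.range_twistOrbit_symm ▸ h.symm.mapsTo_fst

end TwistPair

/-! ### The Kauffman bracket modulo five -/

namespace TangleDiagram

section Bracket

variable {R : Type*} [CommRing R]

/-- Functions on the states of the strands at some height of a diagram. The states of these
finitely many strands are padded to an infinite sequence, so that the width need not be recorded. -/
abbrev StateFun (R : Type*) := Stream' Bool → R

/-- The operator on functions of states that belongs to a diagram, after one vertical strand has
been put to the left of the diagram. -/
def liftEnd : Module.End R (StateFun R) →ₐ[R] Module.End R (StateFun R) where
  toFun φ :=
    { toFun := fun f s => φ (fun t => f (Stream'.cons s.head t)) s.tail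
      map_add' := fun f g => by
        ext s
        exact congrFun (map_add φ (fun t => f (Stream'.cons s.head t))
          (fun t => g (Stream'.cons s.head t))) s.tail
      map_smul' := fun c f => by
        ext s
        exact congrFun (map_smul φ c (fun t => f (Stream'.cons s.head t))) s.tail }
  map_one' := by
    ext f s
    exact congrArg f (Stream'.eta s)
  map_mul' _ _ := rfl
  map_zero' := rfl
  map_add' _ _ := rfl
  commutes' c := by
    ext f s
    exact congrArg (c * f ·) (Stream'.eta s)

/-- The iterates of `liftEnd`, which put `i` vertical strands to the left. -/
def liftIter : ℕ → (Module.End R (StateFun R) →ₐ[R] Module.End R (StateFun R))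
  | 0 => AlgHom.id R _
  | i + 1 => (liftIter i).comp liftEnd

theorem liftIter_add (i j : ℕ) (φ : Module.End R (StateFun R)) :
    liftIter (i + j) φ = liftIter i (liftIter j φ) := by
  induction j generalizing φ with
  | zero => rfl
  | succ _ ih => exact ih _

/-- The bilinear form on the states of two strands that are joined by a minimum. -/
def pairing (ι : R) : Bool → Bool → R
  | false, true => -ι
  | true, false => 1
  | _, _ => 0

/-- The operator of a maximum. -/
def capEnd (ι : R) : Module.End R (StateFun R) where
  toFun f s := f (Stream'.cons false (Stream'.cons true s)) +
    ι * f (Stream'.cons true (Stream'.cons false s))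
  map_add' f g := by ext s; simp only [Pi.add_apply]; ring
  map_smul' c f := by ext s; simp only [Pi.smul_apply, smul_eq_mul, RingHom.id_apply]; ring

/-- The operator of a minimum. -/
def cupEnd (ι : R) : Module.End R (StateFun R) where
  toFun f s := pairing ι s.head s.tail.head * f s.tail.tail
  map_add' f g := by ext s; simp only [Pi.add_apply]; ring
  map_smul' c f := by ext s; simp only [Pi.smul_apply, smul_eq_mul, RingHom.id_apply]; ring

/-- The operator of the tangle `[0]`, rescaled so that `[1]` becomes `1 - hook ι`. -/
def hook (ι : R) : Module.End R (StateFun R) := ι • (cupEnd ι * capEnd ι)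

/-- The operator of a piece, by Kauffman's skein rule `A [∞] + A⁻¹ [0]` for `[1]` at an eighth root
of unity `A` with square `ι`. The crossings are rescaled by units, so that only `ι` occurs. -/
def pieceEnd (ι : R) : Piece → Module.End R (StateFun R)
  | .cap => capEnd ι
  | .cup => cupEnd ι
  | .pos => 1 - hook ι
  | .neg => 1 + hook ι

/-- The operator of a diagram, a rescaled Kauffman bracket. -/
def bracket (ι : R) (w : Word) : Module.End R (StateFun R) :=
  (w.map fun s => liftIter s.1 (pieceEnd ι s.2)).prod

variable {ι : R}

theorem bracket_nil : bracket ι [] = 1 := rfl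

theorem bracket_cons (s : ℕ × Piece) (w : Word) :
    bracket ι (s :: w) = liftIter s.1 (pieceEnd ι s.2) * bracket ι w :=
  List.prod_cons

theorem bracket_append (u v : Word) : bracket ι (u ++ v) = bracket ι u * bracket ι v := by
  simp only [bracket, List.map_append, List.prod_append]

theorem bracket_replicate (n i : ℕ) (g : Piece) :
    bracket ι (List.replicate n (i, g)) = liftIter i (pieceEnd ι g ^ n) := by
  simp only [bracket, List.map_replicate, List.prod_replicate, map_pow]

theorem bracket_shift (k : ℕ) (w : Word) : bracket ι (shift k w) = liftIter k (bracket ι w) := by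
  simp only [bracket, shift, map_list_prod, List.map_map, Function.comp_def, liftIter_add]

theorem capEnd_mul_liftEnd (φ : Module.End R (StateFun R)) :
    capEnd ι * liftEnd (liftEnd φ) = φ * capEnd ι := by
  ext f s
  have hcap : capEnd ι f = (fun t => f (Stream'.cons false (Stream'.cons true t))) +
    ι • (fun t => f (Stream'.cons true (Stream'.cons false t))) := rfl
  rw [Module.End.mul_apply, Module.End.mul_apply, hcap, map_add, map_smul]
  rfl

theorem cupEnd_mul (φ : Module.End R (StateFun R)) :
    cupEnd ι * φ = liftEnd (liftEnd φ) * cupEnd ι := by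
  ext f s
  exact (congrFun (map_smul φ (pairing ι s.head s.tail.head) f) s.tail.tail).symm

theorem hook_mul_liftEnd (φ : Module.End R (StateFun R)) :
    hook ι * liftEnd (liftEnd φ) = liftEnd (liftEnd φ) * hook ι := by
  rw [hook, smul_mul_assoc, mul_assoc, capEnd_mul_liftEnd, ← mul_assoc, cupEnd_mul, mul_assoc,
    mul_smul_comm]

theorem pieceEnd_mul_liftIter (g : Piece) (φ : Module.End R (StateFun R)) :
    pieceEnd ι g * liftIter g.cod φ = liftIter g.dom φ * pieceEnd ι g := by
  cases g with
  | cap => exact capEnd_mul_liftEnd φ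
  | cup => exact cupEnd_mul φ
  | pos =>
    change (1 - hook ι) * liftEnd (liftEnd φ) = liftEnd (liftEnd φ) * (1 - hook ι)
    rw [sub_mul, mul_sub, one_mul, mul_one, hook_mul_liftEnd]
  | neg =>
    change (1 + hook ι) * liftEnd (liftEnd φ) = liftEnd (liftEnd φ) * (1 + hook ι)
    rw [add_mul, mul_add, one_mul, mul_one, hook_mul_liftEnd]

theorem capEnd_mul_cupEnd : capEnd ι * cupEnd ι = 0 := by
  ext f s
  have hloop : -ι * f s + ι * (1 * f s) = 0 := by ring
  exact hloop

theorem capEnd_mul_liftEnd_cupEnd (hι : ι ^ 2 = -1) : capEnd ι * liftEnd (cupEnd ι) = 1 := by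
  ext f s
  change pairing ι true s.head * f (Stream'.cons false s.tail) +
    ι * (pairing ι false s.head * f (Stream'.cons true s.tail)) = f s
  conv_rhs => rw [← Stream'.eta s]
  cases s.head
  · simp only [pairing]; ring
  · simp only [pairing]; linear_combination (-f (Stream'.cons true s.tail)) * hι

theorem liftEnd_capEnd_mul_cupEnd (hι : ι ^ 2 = -1) : liftEnd (capEnd ι) * cupEnd ι = 1 := by
  ext f s
  change pairing ι s.head false * f (Stream'.cons true s.tail) +
    ι * (pairing ι s.head true * f (Stream'.cons false s.tail)) = f s
  conv_rhs => rw [← Stream'.eta s]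
  cases s.head
  · simp only [pairing]; linear_combination (-f (Stream'.cons false s.tail)) * hι
  · simp only [pairing]; ring

theorem capEnd_mul_hook : capEnd ι * hook ι = 0 := by
  rw [hook, mul_smul_comm, ← mul_assoc, capEnd_mul_cupEnd, zero_mul, smul_zero]

theorem hook_mul_cupEnd : hook ι * cupEnd ι = 0 := by
  rw [hook, smul_mul_assoc, mul_assoc, capEnd_mul_cupEnd, mul_zero, smul_zero]

theorem hook_mul_hook : hook ι * hook ι = 0 := by
  rw [hook, smul_mul_assoc, ← hook, mul_assoc, capEnd_mul_hook, mul_zero, smul_zero]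

theorem capEnd_mul_liftEnd_hook (hι : ι ^ 2 = -1) :
    capEnd ι * liftEnd (hook ι) = ι • liftEnd (capEnd ι) := by
  rw [hook, map_smul, mul_smul_comm, map_mul, ← mul_assoc, capEnd_mul_liftEnd_cupEnd hι, one_mul]

theorem liftEnd_capEnd_mul_hook (hι : ι ^ 2 = -1) :
    liftEnd (capEnd ι) * hook ι = ι • capEnd ι := by
  rw [hook, mul_smul_comm, ← mul_assoc, liftEnd_capEnd_mul_cupEnd hι, one_mul]

theorem liftEnd_hook_mul_cupEnd (hι : ι ^ 2 = -1) :
    liftEnd (hook ι) * cupEnd ι = ι • liftEnd (cupEnd ι) := by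
  rw [hook, map_smul, smul_mul_assoc, map_mul, mul_assoc, liftEnd_capEnd_mul_cupEnd hι, mul_one]

theorem hook_mul_liftEnd_cupEnd (hι : ι ^ 2 = -1) :
    hook ι * liftEnd (cupEnd ι) = ι • cupEnd ι := by
  rw [hook, smul_mul_assoc, mul_assoc, capEnd_mul_liftEnd_cupEnd hι, mul_one]

theorem hook_mul_liftEnd_hook_mul_hook (hι : ι ^ 2 = -1) :
    hook ι * liftEnd (hook ι) * hook ι = -hook ι := by
  have hh : hook ι = ι • (cupEnd ι * capEnd ι) := rfl
  conv_lhs => enter [1, 1]; rw [hh]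
  rw [smul_mul_assoc, mul_assoc (cupEnd ι), capEnd_mul_liftEnd_hook hι, mul_smul_comm, smul_smul,
    smul_mul_assoc, mul_assoc, liftEnd_capEnd_mul_hook hι, mul_smul_comm, ← hh, ← sq, hι,
    neg_one_smul]

theorem liftEnd_hook_mul_hook_mul_liftEnd_hook (hι : ι ^ 2 = -1) :
    liftEnd (hook ι) * hook ι * liftEnd (hook ι) = -liftEnd (hook ι) := by
  have hh : hook ι = ι • (cupEnd ι * capEnd ι) := rfl
  conv_lhs => enter [1, 2]; rw [hh]
  rw [mul_smul_comm, ← mul_assoc, liftEnd_hook_mul_cupEnd hι, smul_mul_assoc, smul_mul_assoc,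
    smul_mul_assoc, mul_assoc, capEnd_mul_liftEnd_hook hι, mul_smul_comm, ← map_mul, ← map_smul,
    ← hh, smul_smul, ← sq, hι, neg_one_smul]

end Bracket

theorem one_sub_braid {E : Type*} [Ring E] {x y : E} (hx : x * x = 0) (hy : y * y = 0)
    (hxyx : x * y * x = -x) (hyxy : y * x * y = -y) :
    (1 - x) * (1 - y) * (1 - x) = (1 - y) * (1 - x) * (1 - y) := by
  simp only [sub_mul, mul_sub, one_mul, mul_one, hx, hy, hxyx, hyxy]
  abel

theorem one_add_pow_of_mul_self_eq_zero {E : Type*} [Ring E] {x : E} (hx : x * x = 0) (n : ℕ) :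
    (1 + x) ^ n = 1 + n • x := by
  induction n with
  | zero => simp
  | succ n ih =>
    rw [pow_succ, ih, mul_add, mul_one, add_mul, one_mul, smul_mul_assoc, hx]
    module

section Invariance

variable {R : Type*} [CommRing R] {ι : R}

theorem capEnd_mul_pos : capEnd ι * pieceEnd ι .pos = capEnd ι := by
  rw [pieceEnd, mul_sub, mul_one, capEnd_mul_hook, sub_zero]

theorem capEnd_mul_neg : capEnd ι * pieceEnd ι .neg = capEnd ι := by
  rw [pieceEnd, mul_add, mul_one, capEnd_mul_hook, add_zero]

theorem pos_mul_cupEnd : pieceEnd ι .pos * cupEnd ι = cupEnd ι := by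
  rw [pieceEnd, sub_mul, one_mul, hook_mul_cupEnd, sub_zero]

theorem neg_mul_cupEnd : pieceEnd ι .neg * cupEnd ι = cupEnd ι := by
  rw [pieceEnd, add_mul, one_mul, hook_mul_cupEnd, add_zero]

theorem pieceEnd_pos_mul_neg : pieceEnd ι .pos * pieceEnd ι .neg = 1 := by
  simp only [pieceEnd, sub_mul, mul_add, mul_one, one_mul, hook_mul_hook]
  abel

theorem pieceEnd_neg_mul_pos : pieceEnd ι .neg * pieceEnd ι .pos = 1 := by
  simp only [pieceEnd, mul_sub, add_mul, mul_one, one_mul, hook_mul_hook]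
  abel

theorem pieceEnd_braid (hι : ι ^ 2 = -1) :
    pieceEnd ι .pos * liftEnd (pieceEnd ι .pos) * pieceEnd ι .pos =
      liftEnd (pieceEnd ι .pos) * pieceEnd ι .pos * liftEnd (pieceEnd ι .pos) := by
  simp only [pieceEnd, map_sub, map_one]
  exact one_sub_braid hook_mul_hook (by rw [← map_mul, hook_mul_hook, map_zero])
    (hook_mul_liftEnd_hook_mul_hook hι) (liftEnd_hook_mul_hook_mul_liftEnd_hook hι)

theorem capEnd_mul_liftEnd_pos (hι : ι ^ 2 = -1) :
    capEnd ι * liftEnd (pieceEnd ι .pos) = ι ^ 3 • (liftEnd (capEnd ι) * pieceEnd ι .neg) := by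
  simp only [pieceEnd, map_sub, map_one, mul_sub, mul_add, mul_one, capEnd_mul_liftEnd_hook hι,
    liftEnd_capEnd_mul_hook hι]
  match_scalars
  · linear_combination (1 - ι ^ 2) * hι
  · linear_combination -ι * hι

theorem capEnd_mul_liftEnd_neg (hι : ι ^ 2 = -1) :
    capEnd ι * liftEnd (pieceEnd ι .neg) = ι • (liftEnd (capEnd ι) * pieceEnd ι .pos) := by
  simp only [pieceEnd, map_add, map_one, mul_sub, mul_add, mul_one, capEnd_mul_liftEnd_hook hι,
    liftEnd_capEnd_mul_hook hι]
  match_scalars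
  · linear_combination hι
  · ring

theorem liftEnd_pos_mul_cupEnd (hι : ι ^ 2 = -1) :
    liftEnd (pieceEnd ι .pos) * cupEnd ι = ι ^ 3 • (pieceEnd ι .neg * liftEnd (cupEnd ι)) := by
  simp only [pieceEnd, map_sub, map_one, sub_mul, add_mul, one_mul, liftEnd_hook_mul_cupEnd hι,
    hook_mul_liftEnd_cupEnd hι]
  match_scalars
  · linear_combination (1 - ι ^ 2) * hι
  · linear_combination -ι * hι

theorem liftEnd_neg_mul_cupEnd (hι : ι ^ 2 = -1) :
    liftEnd (pieceEnd ι .neg) * cupEnd ι = ι • (pieceEnd ι .pos * liftEnd (cupEnd ι)) := by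
  simp only [pieceEnd, map_add, map_one, sub_mul, add_mul, one_mul, liftEnd_hook_mul_cupEnd hι,
    hook_mul_liftEnd_cupEnd hι]
  match_scalars
  · linear_combination hι
  · ring

theorem bracket_localIsotopy (hι : ι ^ 2 = -1) {a b : Word} (h : LocalIsotopy a b) :
    ∃ k : ℕ, bracket ι a = ι ^ k • bracket ι b := by
  have scaled {a b : Word} (k : ℕ) (h : bracket ι a = ι ^ k • bracket ι b) (i : ℕ) :
      ∃ k : ℕ, bracket ι (shift i a) = ι ^ k • bracket ι (shift i b) :=
    ⟨k, by rw [bracket_shift, bracket_shift, h, map_smul]⟩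
  have unscaled {a b : Word} (h : bracket ι a = bracket ι b) (i : ℕ) :
      ∃ k : ℕ, bracket ι (shift i a) = ι ^ k • bracket ι (shift i b) :=
    scaled 0 (by rw [h, pow_zero, one_smul]) i
  cases h with
  | exchange i k g h =>
    refine ⟨0, ?_⟩
    simp only [bracket_cons, bracket_nil, mul_one, liftIter_add, ← map_mul, pieceEnd_mul_liftIter,
      pow_zero, one_smul]
  | zigzag_right =>
    exact unscaled (a := [(0, .cap), (1, .cup)]) (b := []) (capEnd_mul_liftEnd_cupEnd hι) _
  | zigzag_left =>
    exact unscaled (a := [(1, .cap), (0, .cup)]) (b := []) (liftEnd_capEnd_mul_cupEnd hι) _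
  | slide_cap_pos =>
    exact scaled (a := [(0, .cap), (1, .pos)]) (b := [(1, .cap), (0, .neg)]) 3
      (capEnd_mul_liftEnd_pos hι) _
  | slide_cap_neg =>
    exact scaled (a := [(0, .cap), (1, .neg)]) (b := [(1, .cap), (0, .pos)]) 1
      (by rw [pow_one]; exact capEnd_mul_liftEnd_neg hι) _
  | slide_cup_pos =>
    exact scaled (a := [(1, .pos), (0, .cup)]) (b := [(0, .neg), (1, .cup)]) 3
      (liftEnd_pos_mul_cupEnd hι) _
  | slide_cup_neg =>
    exact scaled (a := [(1, .neg), (0, .cup)]) (b := [(0, .pos), (1, .cup)]) 1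
      (by rw [pow_one]; exact liftEnd_neg_mul_cupEnd hι) _
  | r1_cap_pos => exact unscaled (a := [(0, .cap), (0, .pos)]) (b := [(0, .cap)]) capEnd_mul_pos _
  | r1_cap_neg => exact unscaled (a := [(0, .cap), (0, .neg)]) (b := [(0, .cap)]) capEnd_mul_neg _
  | r1_cup_pos => exact unscaled (a := [(0, .pos), (0, .cup)]) (b := [(0, .cup)]) pos_mul_cupEnd _
  | r1_cup_neg => exact unscaled (a := [(0, .neg), (0, .cup)]) (b := [(0, .cup)]) neg_mul_cupEnd _
  | r2_pos_neg => exact unscaled (a := [(0, .pos), (0, .neg)]) (b := []) pieceEnd_pos_mul_neg _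
  | r2_neg_pos => exact unscaled (a := [(0, .neg), (0, .pos)]) (b := []) pieceEnd_neg_mul_pos _
  | r3 =>
    exact unscaled (a := [(0, .pos), (1, .pos), (0, .pos)])
      (b := [(1, .pos), (0, .pos), (1, .pos)]) (pieceEnd_braid hι) _

theorem bracket_localFiveMove (h5 : (5 : R) = 0) {a b : Word} (h : LocalFiveMove a b) :
    bracket ι a = bracket ι b := by
  have five_smul (x : Module.End R (StateFun R)) : 5 • x = 0 := by
    rw [← Nat.cast_smul_eq_nsmul R, Nat.cast_ofNat, h5, zero_smul]
  cases h with
  | pos i =>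
    have hneg : -hook ι * -hook ι = 0 := by
      rw [neg_mul_neg (hook ι) (hook ι), hook_mul_hook]
    rw [bracket_replicate, pieceEnd, sub_eq_add_neg, one_add_pow_of_mul_self_eq_zero hneg,
      five_smul, add_zero, map_one, bracket_nil]
  | neg i =>
    rw [bracket_replicate, pieceEnd, one_add_pow_of_mul_self_eq_zero hook_mul_hook, five_smul,
      add_zero, map_one, bracket_nil]

theorem bracket_inContext {r : Word → Word → Prop}
    (hr : ∀ a b, r a b → ∃ k : ℕ, bracket ι a = ι ^ k • bracket ι b) {w w' : Word}
    (h : InContext r w w') : ∃ k : ℕ, bracket ι w = ι ^ k • bracket ι w' := by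
  obtain ⟨u, v, a, b, hab, rfl, rfl⟩ := h
  obtain ⟨k, hk⟩ := hr a b hab
  exact ⟨k, by simp only [bracket_append, hk, mul_smul_comm, smul_mul_assoc]⟩

theorem bracket_fiveMoveEquiv (hι : ι ^ 2 = -1) (h5 : (5 : R) = 0) {n m : ℕ} {S T : Tangle n m}
    (h : S.FiveMoveEquiv T) : ∃ k : ℕ, bracket ι S.1 = ι ^ k • bracket ι T.1 := by
  induction h with
  | rel S T h =>
    exact h.elim (bracket_inContext fun _ _ => bracket_localIsotopy hι)
      (bracket_inContext fun _ _ hab =>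
        ⟨0, by rw [bracket_localFiveMove h5 hab, pow_zero, one_smul]⟩)
  | refl S => exact ⟨0, by rw [pow_zero, one_smul]⟩
  | symm S T _ ih =>
    obtain ⟨k, hk⟩ := ih
    have hι4 : ι ^ 4 = 1 := by linear_combination (ι ^ 2 - 1) * hι
    exact ⟨3 * k, by rw [hk, smul_smul, ← pow_add, show 3 * k + k = 4 * k by ring, pow_mul, hι4,
      one_pow, one_smul]⟩
  | trans S T U _ _ ih ih' =>
    obtain ⟨k, hk⟩ := ih
    obtain ⟨l, hl⟩ := ih'
    exact ⟨k + l, by rw [hk, hl, smul_smul, pow_add]⟩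

/-- The 2-tangle `T` has, up to a power of `ι`, the same bracket as a rational tangle with fraction
`p / q`. The class of a tangle only determines the pair `(p, q)` up to sign, and only in `R`. -/
def HasFraction (ι : R) (T : Tangle 2 2) (p q : ℤ) : Prop :=
  ∃ k : ℕ, bracket ι T.1 = ι ^ k • ((p : R) • 1 - (q : R) • hook ι)

theorem hasFraction_infty : HasFraction ι Tangle.infty 1 0 :=
  ⟨0, by simp [Tangle.infty, bracket_nil]⟩

theorem bracket_piece (g : Piece) : bracket ι [(0, g)] = pieceEnd ι g := mul_one _

theorem hasFraction_one : HasFraction ι Tangle.one 1 1 :=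
  ⟨0, by simp [Tangle.one, bracket_piece, pieceEnd]⟩

theorem hasFraction_negOne (hι : ι ^ 2 = -1) : HasFraction ι Tangle.negOne (-1) 1 := by
  refine ⟨2, ?_⟩
  simp only [Tangle.negOne, bracket_piece, pieceEnd, hι]
  push_cast
  module

theorem hasFraction_zero (hι : ι ^ 2 = -1) : HasFraction ι Tangle.zero 0 1 := by
  have hzero : bracket ι Tangle.zero.1 = cupEnd ι * capEnd ι := rfl
  refine ⟨1, ?_⟩
  rw [hzero, hook, Int.cast_zero, Int.cast_one]
  match_scalars
  · linear_combination hι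
  · ring

theorem HasFraction.stack {S T : Tangle 2 2} {p q p' q' : ℤ} (hS : HasFraction ι S p q)
    (hT : HasFraction ι T p' q') : HasFraction ι (S.stack T) (p * p') (p * q' + q * p') := by
  obtain ⟨k, hk⟩ := hS
  obtain ⟨l, hl⟩ := hT
  refine ⟨k + l, ?_⟩
  rw [show (S.stack T).1 = S.1 ++ T.1 from rfl, bracket_append, hk, hl, smul_mul_smul_comm,
    pow_add]
  simp only [sub_mul, mul_sub, smul_mul_smul_comm, one_mul, mul_one, hook_mul_hook, smul_zero]
  push_cast
  module

theorem capEnd_mul_beside_mul_cupEnd (hι : ι ^ 2 = -1) (p q p' q' : R) :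
    liftEnd (capEnd ι) * (p • 1 - q • hook ι) * liftEnd (liftEnd (p' • 1 - q' • hook ι)) *
      liftEnd (cupEnd ι) = ι ^ 3 • ((p * q' + q * p') • 1 - (q * q') • hook ι) := by
  set φ : Module.End R (StateFun R) := p' • 1 - q' • hook ι with hφ
  have hleft : liftEnd (capEnd ι) * (p • 1 - q • hook ι) =
      p • liftEnd (capEnd ι) - (q * ι) • capEnd ι := by
    rw [mul_sub, mul_smul_comm, mul_smul_comm, mul_one, liftEnd_capEnd_mul_hook hι, smul_smul]
  have hloop : liftEnd (capEnd ι) * liftEnd (liftEnd φ) * liftEnd (cupEnd ι) =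
      (-(q' * ι)) • 1 := by
    rw [hφ, ← map_mul, ← map_mul, map_sub, map_smul, map_smul, map_one, mul_sub, mul_smul_comm,
      mul_smul_comm, mul_one, capEnd_mul_liftEnd_hook hι, sub_mul, smul_mul_assoc, smul_mul_assoc,
      smul_mul_assoc, capEnd_mul_cupEnd, liftEnd_capEnd_mul_cupEnd hι, smul_zero, zero_sub,
      smul_smul, ← neg_smul, map_smul, map_one]
  have hzigzag : capEnd ι * liftEnd (liftEnd φ) * liftEnd (cupEnd ι) = φ := by
    rw [capEnd_mul_liftEnd, mul_assoc, capEnd_mul_liftEnd_cupEnd hι, mul_one]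
  rw [hleft, sub_mul, sub_mul, smul_mul_assoc, smul_mul_assoc, smul_mul_assoc, smul_mul_assoc,
    hloop, hzigzag, hφ]
  match_scalars
  · linear_combination (-(p * q' + q * p') * ι) * hι
  · linear_combination (q * q' * ι) * hι

theorem HasFraction.beside (hι : ι ^ 2 = -1) {S T : Tangle 2 2} {p q p' q' : ℤ}
    (hS : HasFraction ι S p q) (hT : HasFraction ι T p' q') :
    HasFraction ι (S.beside T) (p * q' + q * p') (q * q') := by
  obtain ⟨k, hk⟩ := hS
  obtain ⟨l, hl⟩ := hT
  have hbeside : bracket ι (S.beside T).1 =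
      liftEnd (capEnd ι) * bracket ι S.1 * liftEnd (liftEnd (bracket ι T.1)) *
        liftEnd (cupEnd ι) := by
    change liftEnd (capEnd ι) * bracket ι (S.1 ++ shift 2 T.1 ++ [(1, .cup)]) = _
    rw [bracket_append, bracket_append, bracket_shift, ← mul_assoc, ← mul_assoc]
    rfl
  refine ⟨k + l + 3, ?_⟩
  rw [hbeside, hk, hl, map_smul, map_smul, mul_smul_comm, mul_smul_comm, smul_mul_assoc,
    smul_mul_assoc, smul_mul_assoc, capEnd_mul_beside_mul_cupEnd hι, smul_smul, smul_smul,
    ← pow_add, ← pow_add, add_comm l]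
  push_cast
  rfl

theorem eq_of_smul_one_sub_smul_hook_eq (hι : ι ^ 2 = -1) {p q p' q' : R}
    (h : p • 1 - q • hook ι = p' • 1 - q' • hook ι) : p = p' ∧ q = q' := by
  let s : Stream' Bool := Stream'.const false
  have apply_eq (p q : R) (f : StateFun R) (x y : Bool) :
      (p • 1 - q • hook ι) f (Stream'.cons x (Stream'.cons y s)) =
        p * f (Stream'.cons x (Stream'.cons y s)) - q * (ι * (pairing ι x y *
          (f (Stream'.cons false (Stream'.cons true s)) +
            ι * f (Stream'.cons true (Stream'.cons false s))))) := rfl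
  have hff := congrFun (LinearMap.congr_fun h 1) (Stream'.cons false (Stream'.cons false s))
  have htf := congrFun (LinearMap.congr_fun h fun t => if t.head then 0 else 1)
    (Stream'.cons true (Stream'.cons false s))
  rw [apply_eq, apply_eq] at hff htf
  simp only [pairing, Pi.one_apply, Stream'.head_cons, if_true, Bool.false_eq_true, if_false,
    mul_zero, zero_mul, mul_one, add_zero, sub_zero, zero_sub] at hff htf
  exact ⟨hff, by linear_combination ι * htf + (q - q') * hι⟩

theorem HasFraction.eq_pow_mul (hι : ι ^ 2 = -1) {S T : Tangle 2 2} {p q p' q' : ℤ}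
    (hS : HasFraction ι S p q) (hT : HasFraction ι T p' q') {k : ℕ}
    (h : bracket ι S.1 = ι ^ k • bracket ι T.1) :
    ∃ l : ℕ, (p : R) = ι ^ l * p' ∧ (q : R) = ι ^ l * q' := by
  obtain ⟨s, hs⟩ := hS
  obtain ⟨t, ht⟩ := hT
  have hι4 : ι ^ (3 * s) * ι ^ s = 1 := by
    rw [← pow_add, show 3 * s + s = 2 * (2 * s) by ring, pow_mul, hι, pow_mul, neg_one_sq, one_pow]
  refine ⟨3 * s + k + t, eq_of_smul_one_sub_smul_hook_eq hι ?_⟩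
  calc (p : R) • 1 - (q : R) • hook ι = ι ^ (3 * s) • bracket ι S.1 := by
        rw [hs, smul_smul, hι4, one_smul]
    _ = ι ^ (3 * s + k + t) • ((p' : R) • 1 - (q' : R) • hook ι) := by
      rw [h, ht, smul_smul, smul_smul, ← pow_add, ← pow_add, add_assoc]
    _ = (ι ^ (3 * s + k + t) * p') • 1 - (ι ^ (3 * s + k + t) * q') • hook ι := by
      rw [smul_sub, smul_smul, smul_smul]

/-- Twelve pairs `(p, q)` such that `p / q` is the fraction of the corresponding basic tangle. -/
def basicFraction : Fin 12 → ℤ × ℤ :=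
  ![(1, 0), (0, 1), (-1, 1), (1, 1), (-2, 1), (2, 1), (2, 5), (5, 2), (3, 2), (3, -2), (1, 2),
    (1, -2)]

theorem hasFraction_basic (hι : ι ^ 2 = -1) (i : Fin 12) :
    HasFraction ι (Tangle.basic i) (basicFraction i).1 (basicFraction i).2 := by
  have one : HasFraction ι Tangle.one 1 1 := hasFraction_one
  have negOne : HasFraction ι Tangle.negOne (-1) 1 := hasFraction_negOne hι
  have two : HasFraction ι Tangle.two 2 1 := (one.beside hι one :)
  have negTwo : HasFraction ι Tangle.negTwo (-2) 1 := (negOne.beside hι negOne :)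
  have half : HasFraction ι Tangle.half 1 2 := (one.stack one :)
  have negHalf : HasFraction ι Tangle.negHalf 1 (-2) := (negOne.stack negOne :)
  have twoFifths : HasFraction ι Tangle.twoFifths 2 5 := (half.stack two :)
  have fiveHalves : HasFraction ι Tangle.fiveHalves 5 2 := (two.beside hι half :)
  have threeHalves : HasFraction ι Tangle.threeHalves 3 2 := (one.beside hι half :)
  have negThreeHalves : HasFraction ι Tangle.negThreeHalves 3 (-2) := (negOne.beside hι negHalf :)
  fin_cases i
  exacts [hasFraction_infty, hasFraction_zero hι, negOne, one, negTwo, two, twoFifths, fiveHalves,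
    threeHalves, negThreeHalves, half, negHalf]

end Invariance

/-- The ring `𝔽₅[ι] / (ι ^ 2 + 1)`. It is needed although `𝔽₅` contains a square root of `-1`,
because a product `ι * p` with `p : 𝔽₅` must not lie in `𝔽₅` unless `p = 0`. -/
abbrev GaussianFive := QuadraticAlgebra (ZMod 5) (-1) 0

theorem basicFraction_injective_up_to_units (i j : Fin 12) (k : Fin 4)
    (hp : ((basicFraction i).1 : GaussianFive) = ⟨0, 1⟩ ^ (k : ℕ) * (basicFraction j).1)
    (hq : ((basicFraction i).2 : GaussianFive) = ⟨0, 1⟩ ^ (k : ℕ) * (basicFraction j).2) :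
    i = j := by
  decide +revert

theorem eq_of_fiveMoveEquiv_basic {i j : Fin 12}
    (h : (Tangle.basic i).FiveMoveEquiv (Tangle.basic j)) : i = j := by
  have hι : (⟨0, 1⟩ : GaussianFive) ^ 2 = -1 := by decide
  have hι4 : (⟨0, 1⟩ : GaussianFive) ^ 4 = 1 := by decide
  obtain ⟨k, hk⟩ := bracket_fiveMoveEquiv hι (by decide) h
  obtain ⟨l, hp, hq⟩ := (hasFraction_basic hι i).eq_pow_mul hι (hasFraction_basic hι j) hk
  rw [pow_eq_pow_mod l hι4] at hp hq
  exact basicFraction_injective_up_to_units i j ⟨l % 4, Nat.mod_lt l (by decide)⟩ hp hq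

end TangleDiagram

/-! ### Moves of diagrams -/

namespace TangleDiagram

@[simp]
theorem shift_nil (k : ℕ) : shift k [] = [] := rfl

@[simp]
theorem shift_cons (k i : ℕ) (g : Piece) (w : Word) :
    shift k ((i, g) :: w) = (k + i, g) :: shift k w := rfl

@[simp]
theorem shift_append (k : ℕ) (u v : Word) : shift k (u ++ v) = shift k u ++ shift k v :=
  List.map_append

@[simp]
theorem shift_shift (k l : ℕ) (w : Word) : shift k (shift l w) = shift (k + l) w := by
  simp [shift, Nat.add_assoc]

@[simp]
theorem shift_zero (w : Word) : shift 0 w = w := by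
  simp [shift]

theorem typed_append_iff {u v : Word} {n l : ℕ} :
    Typed (u ++ v) n l ↔ ∃ m, Typed u n m ∧ Typed v m l := by
  refine ⟨fun h => ?_, fun ⟨_, hu, hv⟩ => hu.append hv⟩
  induction u generalizing n with
  | nil => exact ⟨n, rfl, h⟩
  | cons s u ih =>
    obtain ⟨m, hu, hv⟩ := ih h.2
    exact ⟨m, ⟨h.1, hu⟩, hv⟩

theorem typed_singleton {i n m : ℕ} {g : Piece} (hi : i + g.dom ≤ n)
    (hm : m + g.dom = n + g.cod) : Typed [(i, g)] n m :=
  ⟨hi, show n - g.dom + g.cod = m by omega⟩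

theorem InContext.insert {r : Word → Word → Prop} {w w' : Word} {k : ℕ} (h : InContext r w w')
    (hr : ∀ a b, r a b → r (shift k a) (shift k b)) (u v : Word) :
    InContext r (u ++ shift k w ++ v) (u ++ shift k w' ++ v) := by
  obtain ⟨x, y, a, b, hab, rfl, rfl⟩ := h
  exact ⟨u ++ shift k x, shift k y ++ v, _, _, hr a b hab, by simp, by simp⟩

theorem LocalIsotopy.shift {a b : Word} (k : ℕ) (h : LocalIsotopy a b) :
    LocalIsotopy (shift k a) (shift k b) := by
  cases h
  case exchange i j g h => simpa [Nat.add_assoc] using LocalIsotopy.exchange (k + i) j g h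
  all_goals constructor

theorem LocalFiveMove.shift {a b : Word} (k : ℕ) (h : LocalFiveMove a b) :
    LocalFiveMove (shift k a) (shift k b) := by
  cases h <;> constructor

theorem LocalIsotopy.typed {a b : Word} {n m : ℕ} (h : LocalIsotopy a b) (ha : Typed a n m) :
    Typed b n m := by
  cases h <;> simp only [Typed, Piece.dom, Piece.cod] at ha ⊢ <;> omega

end TangleDiagram

namespace Tangle

variable {n m n' m' : ℕ} {S T : Tangle n m}

/-- Maps that place a tangle in a larger diagram, with `k` strands on its left. -/
def IsInsertion (F : Tangle n m → Tangle n' m') : Prop :=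
  ∃ (u v : Word) (k : ℕ), ∀ T, (F T).1 = u ++ shift k T.1 ++ v

theorem FiveMoveEquiv.map {F : Tangle n m → Tangle n' m'} (hF : IsInsertion F)
    (h : S.FiveMoveEquiv T) : (F S).FiveMoveEquiv (F T) := by
  obtain ⟨u, v, k, hF⟩ := hF
  induction h with
  | rel S T h =>
    refine .rel _ _ ?_
    rw [hF, hF]
    exact h.imp (·.insert (fun _ _ => .shift k) u v) (·.insert (fun _ _ => .shift k) u v)
  | refl S => exact .refl _
  | symm S T _ ih => exact .symm _ _ ih
  | trans S T U _ _ ih ih' => exact .trans _ _ _ ih ih'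

theorem Isotopic.fiveMoveEquiv (h : S.Isotopic T) : S.FiveMoveEquiv T :=
  Relation.EqvGen.mono (fun _ _ => Or.inl) _ _ h

end Tangle

namespace TangleDiagram

/-- Whenever `a` is a diagram of a tangle, so is `b`, with the same ends, and the two tangles are
`5`-move equivalent. The requirement on the ends is one-sided, because a piece that is created next
to a diagram need not fit into its width. -/
def Reduces (a b : Word) : Prop :=
  ∀ ⦃n m : ℕ⦄ (ha : Typed a n m),
    ∃ hb : Typed b n m, Tangle.FiveMoveEquiv (⟨a, ha⟩ : Tangle n m) ⟨b, hb⟩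

scoped infix:50 " ↝ " => Reduces

namespace Reduces

variable {a b c : Word}

theorem refl (a : Word) : a ↝ a := fun _ _ ha => ⟨ha, .refl _⟩

theorem trans (h : a ↝ b) (h' : b ↝ c) : a ↝ c := fun _ _ ha =>
  have ⟨hb, hab⟩ := h ha
  have ⟨hc, hbc⟩ := h' hb
  ⟨hc, .trans _ _ _ hab hbc⟩

instance : Trans Reduces Reduces Reduces := ⟨trans⟩

instance : IsPreorder Word Reduces where
  refl := refl
  trans _ _ _ := trans

theorem append (h : a ↝ b) (u v : Word) : u ++ a ++ v ↝ u ++ b ++ v := by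
  intro n m hw
  obtain ⟨q, hua, hv⟩ := typed_append_iff.1 hw
  obtain ⟨p, hu, ha⟩ := typed_append_iff.1 hua
  obtain ⟨hb, hab⟩ := h ha
  exact ⟨(hu.append hb).append hv, hab.map
    (F := fun T : Tangle p q => ⟨u ++ T.1 ++ v, (hu.append T.2).append hv⟩)
    ⟨u, v, 0, fun T => by simp⟩⟩

theorem of_localIsotopy (h : LocalIsotopy a b) : a ↝ b := fun _ _ ha =>
  ⟨h.typed ha, .rel _ _ (.inl ⟨[], [], a, b, h, by simp, by simp⟩)⟩

theorem of_localIsotopy_symm (h : LocalIsotopy b a)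
    (hab : ∀ ⦃n m⦄, Typed a n m → Typed b n m) : a ↝ b := fun _ _ ha =>
  ⟨hab ha, .symm _ _ (.rel _ _ (.inl ⟨[], [], b, a, h, by simp, by simp⟩))⟩

theorem of_localFiveMove_symm (h : LocalFiveMove b a)
    (hab : ∀ ⦃n m⦄, Typed a n m → Typed b n m) : a ↝ b := fun _ _ ha =>
  ⟨hab ha, .symm _ _ (.rel _ _ (.inr ⟨[], [], b, a, h, by simp, by simp⟩))⟩

theorem antisymmRel_append (h : AntisymmRel Reduces a b) (u v : Word) :
    AntisymmRel Reduces (u ++ a ++ v) (u ++ b ++ v) :=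
  ⟨append h.1 u v, append h.2 u v⟩

theorem exchange_slices (i k : ℕ) (g h : Piece) :
    AntisymmRel Reduces [(i, g), (i + g.cod + k, h)] [(i + g.dom + k, h), (i, g)] := by
  refine ⟨of_localIsotopy (.exchange i k g h), of_localIsotopy_symm (.exchange i k g h) ?_⟩
  intro n m
  simp only [Typed]
  omega

theorem exchange_slice {i n m : ℕ} {g : Piece} (hg : Typed [(i, g)] n m) (v : Word) :
    AntisymmRel Reduces ((i, g) :: shift m v) (shift n v ++ [(i, g)]) := by
  induction v with
  | nil => exact .rfl
  | cons s v ih =>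
    obtain ⟨j, h⟩ := s
    have hslices := exchange_slices i (n - (i + g.dom) + j) g h
    obtain ⟨hi, hm : n - g.dom + g.cod = m⟩ := hg
    rw [show i + g.cod + (n - (i + g.dom) + j) = m + j by omega,
      show i + g.dom + (n - (i + g.dom) + j) = n + j by omega] at hslices
    exact (antisymmRel_append hslices [] (shift m v)).trans
      (by simpa using antisymmRel_append ih [(n + j, h)] [])

theorem exchange {u : Word} {n m : ℕ} (hu : Typed u n m) (v : Word) :
    AntisymmRel Reduces (u ++ shift m v) (shift n v ++ u) := by
  induction u generalizing n with
  | nil =>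
    obtain rfl : n = m := hu
    simp
  | cons s u ih =>
    obtain ⟨i, g⟩ := s
    have hslice := exchange_slice (n := n) (m := n - g.dom + g.cod) ⟨hu.1, rfl⟩ v
    have htail : AntisymmRel Reduces ((i, g) :: u ++ shift m v)
        ((i, g) :: shift (n - g.dom + g.cod) v ++ u) := by
      simpa using antisymmRel_append (ih hu.2) [(i, g)] []
    exact htail.trans (by simpa using antisymmRel_append hslice [] u)

end Reduces

/-- The crossings, `pos` for `true` and `neg` for `false`. -/
def crossing : Bool → Piece
  | true => .pos
  | false => .neg

theorem typed_crossing (s : Bool) {i n : ℕ} (hi : i + 2 ≤ n) : Typed [(i, crossing s)] n n := by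
  cases s <;> exact typed_singleton hi rfl

theorem Typed.shift_one {w : Word} {n m : ℕ} (h : Typed w n m) :
    Typed (TangleDiagram.shift 1 w) (n + 1) (m + 1) := by
  simpa only [Nat.add_comm 1] using h.shift 1

namespace Reduces

theorem zigzag_right (i : ℕ) : [(i, .cap), (i + 1, .cup)] ↝ [] := of_localIsotopy (.zigzag_right i)

theorem zigzag_left (i : ℕ) : [(i + 1, .cap), (i, .cup)] ↝ [] := of_localIsotopy (.zigzag_left i)

theorem slide_cap (s : Bool) (i : ℕ) :
    [(i, .cap), (i + 1, crossing s)] ↝ [(i + 1, .cap), (i, crossing !s)] := by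
  cases s
  exacts [of_localIsotopy (.slide_cap_neg i), of_localIsotopy (.slide_cap_pos i)]

theorem slide_cap_symm (s : Bool) (i : ℕ) :
    [(i + 1, .cap), (i, crossing s)] ↝ [(i, .cap), (i + 1, crossing !s)] := by
  cases s
  · refine of_localIsotopy_symm (.slide_cap_pos i) fun n m h => ?_
    simp only [Typed, crossing, Bool.not_false, Piece.dom, Piece.cod] at h ⊢
    omega
  · refine of_localIsotopy_symm (.slide_cap_neg i) fun n m h => ?_
    simp only [Typed, crossing, Bool.not_true, Piece.dom, Piece.cod] at h ⊢
    omega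

theorem slide_cup (s : Bool) (i : ℕ) :
    [(i + 1, crossing s), (i, .cup)] ↝ [(i, crossing !s), (i + 1, .cup)] := by
  cases s
  exacts [of_localIsotopy (.slide_cup_neg i), of_localIsotopy (.slide_cup_pos i)]

theorem slide_cup_symm (s : Bool) (i : ℕ) :
    [(i, crossing s), (i + 1, .cup)] ↝ [(i + 1, crossing !s), (i, .cup)] := by
  cases s
  · refine of_localIsotopy_symm (.slide_cup_pos i) fun n m h => ?_
    simp only [Typed, crossing, Bool.not_false, Piece.dom, Piece.cod] at h ⊢
    omega
  · refine of_localIsotopy_symm (.slide_cup_neg i) fun n m h => ?_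
    simp only [Typed, crossing, Bool.not_true, Piece.dom, Piece.cod] at h ⊢
    omega

theorem r1_cap (s : Bool) (i : ℕ) : [(i, .cap), (i, crossing s)] ↝ [(i, .cap)] := by
  cases s
  exacts [of_localIsotopy (.r1_cap_neg i), of_localIsotopy (.r1_cap_pos i)]

theorem r1_cup (s : Bool) (i : ℕ) : [(i, crossing s), (i, .cup)] ↝ [(i, .cup)] := by
  cases s
  exacts [of_localIsotopy (.r1_cup_neg i), of_localIsotopy (.r1_cup_pos i)]

theorem r2 (s : Bool) (i : ℕ) : [(i, crossing !s), (i, crossing s)] ↝ [] := by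
  cases s
  exacts [of_localIsotopy (.r2_pos_neg i), of_localIsotopy (.r2_neg_pos i)]

end Reduces

end TangleDiagram

/-- The tangle `[1]` or `[-1]`. -/
def Tangle.single (s : Bool) : Tangle 2 2 := ⟨[(0, crossing s)], typed_crossing s le_rfl⟩

/-! ### Twists of tangles up to `5`-moves -/

/-- Tangles up to `5`-move equivalence. -/
def TangleClass (n m : ℕ) : Type :=
  Quotient (⟨Tangle.FiveMoveEquiv, Relation.EqvGen.is_equivalence _⟩ : Setoid (Tangle n m))

namespace TangleClass

variable {n m n' m' : ℕ}

/-- The class of a tangle. -/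
def mk (T : Tangle n m) : TangleClass n m := Quotient.mk _ T

theorem ind {P : TangleClass n m → Prop} (h : ∀ T, P (mk T)) (x : TangleClass n m) : P x :=
  Quotient.ind h x

theorem mk_eq_mk {S T : Tangle n m} : mk S = mk T ↔ S.FiveMoveEquiv T := Quotient.eq

theorem mk_eq_of_reduces {S T : Tangle n m} (h : S.1 ↝ T.1) : mk S = mk T :=
  mk_eq_mk.2 (h S.2).2

/-- The map of classes that is induced by an insertion. -/
def map (F : Tangle n m → Tangle n' m') (hF : Tangle.IsInsertion F) :
    TangleClass n m → TangleClass n' m' :=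
  Quotient.map F fun _ _ => .map hF

/-- Turn the last upper end down. -/
def bendRight : TangleClass (n + 1) m → TangleClass n (m + 1) :=
  map (fun T => ⟨(n, .cap) :: T.1, Nat.le_refl n, T.2.add_right 1⟩) ⟨[(n, .cap)], [], 0, by simp⟩

/-- Turn the first upper end down. -/
def bendLeft : TangleClass (n + 1) m → TangleClass n (m + 1) :=
  map (fun T => ⟨(0, .cap) :: shift 1 T.1, Nat.zero_le n, T.2.shift_one⟩)
    ⟨[(0, .cap)], [], 1, by simp⟩

theorem bendRight_injective : Function.Injective (bendRight (n := n) (m := m)) := by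
  let unbend : TangleClass n (m + 1) → TangleClass (n + 1) m :=
    map (fun T => ⟨T.1 ++ [(m, .cup)], (T.2.add_right 1).append (typed_singleton le_rfl rfl)⟩)
      ⟨[], [(m, .cup)], 0, by simp⟩
  refine Function.LeftInverse.injective (g := unbend) (ind fun T => mk_eq_of_reduces ?_)
  calc (n, .cap) :: T.1 ++ [(m, .cup)]
      ↝ [(n, .cap), (n + 1, .cup)] ++ T.1 := by
        simpa using (Reduces.exchange T.2 [(0, .cup)]).1.append [(n, .cap)] []
    _ ↝ T.1 := by simpa using (Reduces.zigzag_right n).append [] T.1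

theorem bendLeft_injective : Function.Injective (bendLeft (n := n) (m := m)) := by
  let unbend : TangleClass n (m + 1) → TangleClass (n + 1) m :=
    map (fun T => ⟨shift 1 T.1 ++ [(0, .cup)], T.2.shift_one.append
      (typed_singleton (show 0 + 2 ≤ _ by omega) rfl)⟩) ⟨[], [(0, .cup)], 1, by simp⟩
  refine Function.LeftInverse.injective (g := unbend) (ind fun T => mk_eq_of_reduces ?_)
  have hcup : Typed [(0, .cup)] 2 0 := typed_singleton le_rfl rfl
  calc shift 1 ((0, .cap) :: shift 1 T.1) ++ [(0, .cup)]
      ↝ [(1, .cap), (0, .cup)] ++ T.1 := by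
        simpa using (Reduces.exchange hcup T.1).2.append [(1, .cap)] []
    _ ↝ T.1 := by simpa using (Reduces.zigzag_left 0).append [] T.1

/-- The permutation `F true` with inverse `F false`. -/
def signedPerm {X : Type*} (F : Bool → X → X) (hF : ∀ s x, F s (F (!s) x) = x) :
    Equiv.Perm X where
  toFun := F true
  invFun := F false
  left_inv := hF false
  right_inv := hF true

theorem mapsTo_of_signedPerm {X : Type*} {F : Bool → X → X} {hF : ∀ s x, F s (F (!s) x) = x}
    {A : Set X} [Finite A] (h : Set.MapsTo (signedPerm F hF) A A) : ∀ s, Set.MapsTo (F s) A A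
  | true => h
  | false => Equiv.Perm.perm_symm_mapsTo_iff_mapsTo.mpr h

/-- Cross the strands that end at the lower ends `i` and `i + 1`. -/
def cross {i : ℕ} (hi : i + 2 ≤ m) (s : Bool) : TangleClass n m → TangleClass n m :=
  map (fun T => ⟨T.1 ++ [(i, crossing s)], T.2.append (typed_crossing s hi)⟩)
    ⟨[], [(i, crossing s)], 0, by simp⟩

theorem cross_cross_not {i : ℕ} (hi : i + 2 ≤ m) (s : Bool) (x : TangleClass n m) :
    cross hi s (cross hi (!s) x) = x := by
  revert x
  exact ind fun T => mk_eq_of_reduces (by simpa using (Reduces.r2 s i).append T.1 [])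

/-- The action on the lower ends of a standard generator of the braid group. -/
def braidGen {i : ℕ} (hi : i + 2 ≤ m) : Equiv.Perm (TangleClass n m) :=
  signedPerm (cross hi) (cross_cross_not hi)

theorem braidGen_pow_five {i : ℕ} (hi : i + 2 ≤ m) : braidGen (n := n) hi ^ 5 = 1 := by
  have htyped {p q : ℕ} (h : Typed (List.replicate 5 (i, .pos)) p q) : Typed [] p q := by
    simp only [List.replicate, Typed, Piece.dom, Piece.cod] at h ⊢
    omega
  refine Equiv.ext (ind fun T => mk_eq_of_reduces ?_)
  simpa [crossing] using (Reduces.of_localFiveMove_symm (.pos i) fun _ _ => htyped).append T.1 []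

theorem braidGen_braid {i : ℕ} (hi : i + 1 + 2 ≤ m) :
    braidGen (n := n) (i := i) (by omega) * braidGen hi * braidGen (i := i) (by omega) =
      braidGen hi * braidGen (i := i) (by omega) * braidGen hi :=
  Equiv.ext <| ind fun T => mk_eq_of_reduces <| by
    simpa [crossing] using (Reduces.of_localIsotopy (.r3 i)).append T.1 []

theorem fiveBraidPair_braidGen {i : ℕ} (hi : i + 1 + 2 ≤ m) :
    FiveBraidPair (braidGen (n := n) (i := i) (by omega)) (braidGen hi) :=
  ⟨braidGen_pow_five _, braidGen_pow_five _, braidGen_braid hi⟩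

/-- Add a crossing on the right. -/
def addRight (s : Bool) : TangleClass 2 2 → TangleClass 2 2 :=
  map (fun T => T.beside (Tangle.single s))
    ⟨[(1, .cap)], [(2, crossing s), (1, .cup)], 0, fun T => by simp [Tangle.beside, Tangle.single]⟩

/-- Add a crossing on the left. -/
def addLeft (s : Bool) : TangleClass 2 2 → TangleClass 2 2 :=
  map (fun T => (Tangle.single s).beside T)
    ⟨[(1, .cap), (0, crossing s)], [(1, .cup)], 2, fun T => by
      simp [Tangle.beside, Tangle.single]⟩

/-- Add a crossing at the top. -/
def addTop (s : Bool) : TangleClass 2 2 → TangleClass 2 2 :=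
  map (fun T => (Tangle.single s).stack T)
    ⟨[(0, crossing s)], [], 0, fun T => by simp [Tangle.stack, Tangle.single]⟩

theorem beside_assoc (S T U : Tangle 2 2) :
    mk ((S.beside T).beside U) = mk (S.beside (T.beside U)) := by
  have hcup : Typed [(1, .cup)] 4 2 := ⟨by decide, rfl⟩
  have hcaps : [(1, .cap), (1, .cap)] ↝ [(1, .cap), (3, .cap)] :=
    (Reduces.exchange_slices 1 0 .cap .cap).2
  have hcups : [(1, .cup), (1, .cup)] ↝ [(3, .cup), (1, .cup)] :=
    (Reduces.exchange_slices 1 0 .cup .cup).1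
  apply mk_eq_of_reduces
  calc ((S.beside T).beside U).1
      ↝ [(1, .cap), (1, .cap)] ++ S.1 ++ shift 2 T.1 ++ shift 4 U.1 ++ [(1, .cup), (1, .cup)] := by
        convert (Reduces.exchange hcup U.1).1.append
          ([(1, .cap), (1, .cap)] ++ S.1 ++ shift 2 T.1) [(1, .cup)]
          using 1 <;> simp [Tangle.beside]
    _ ↝ [(1, .cap), (1, .cap)] ++ S.1 ++ shift 2 T.1 ++ shift 4 U.1 ++ [(3, .cup), (1, .cup)] := by
        convert hcups.append
          ([(1, .cap), (1, .cap)] ++ S.1 ++ shift 2 T.1 ++ shift 4 U.1) [] using 1 <;> simp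
    _ ↝ [(1, .cap), (3, .cap)] ++ S.1 ++ shift 2 T.1 ++ shift 4 U.1 ++ [(3, .cup), (1, .cup)] := by
        convert hcaps.append [] (S.1 ++ shift 2 T.1 ++ shift 4 U.1 ++ [(3, .cup), (1, .cup)])
          using 1 <;> simp
    _ ↝ (S.beside (T.beside U)).1 := by
        convert (Reduces.exchange S.2 [(1, .cap)]).2.append [(1, .cap)]
          (shift 2 T.1 ++ shift 4 U.1 ++ [(3, .cup), (1, .cup)]) using 1 <;> simp [Tangle.beside]

theorem bendRight_addRight (s : Bool) (x : TangleClass 2 2) :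
    bendRight (addRight s x) = cross (i := 1) (by decide) (!s) (bendRight x) := by
  revert x
  refine ind fun T => mk_eq_of_reduces ?_
  have hbend : Typed ([(1, .cap)] ++ T.1 ++ [(1, crossing !s)]) 1 3 :=
    ((typed_singleton le_rfl rfl).append (T.2.add_right 1)).append (typed_crossing _ le_rfl)
  calc (1, .cap) :: (T.beside (.single s)).1
      ↝ [(1, .cap), (1, .cap)] ++ T.1 ++ [(1, crossing !s), (2, .cup)] := by
        convert (Reduces.slide_cup s 1).append ([(1, .cap), (1, .cap)] ++ T.1) []
          using 1 <;> simp [Tangle.beside, Tangle.single]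
    _ ↝ [(1, .cap)] ++ T.1 ++ [(1, crossing !s)] ++ [(3, .cap), (2, .cup)] := by
        convert (Reduces.exchange hbend [(0, .cap)]).2.append [] [(2, .cup)] using 1 <;> simp
    _ ↝ (1, .cap) :: T.1 ++ [(1, crossing !s)] := by
        convert (Reduces.zigzag_left 2).append ([(1, .cap)] ++ T.1 ++ [(1, crossing !s)]) []
          using 1 <;> simp

theorem bendLeft_addLeft (s : Bool) (x : TangleClass 2 2) :
    bendLeft (addLeft s x) = cross (i := 0) (by decide) (!s) (bendLeft x) := by
  revert x
  refine ind fun T => mk_eq_of_reduces ?_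
  have hcap : Typed [(0, .cap)] 0 2 := ⟨le_rfl, rfl⟩
  have hcrossing : Typed [(1, crossing s)] 3 3 := typed_crossing s le_rfl
  calc (0, .cap) :: shift 1 ((Tangle.single s).beside T).1
      ↝ [(0, .cap), (2, .cap)] ++ shift 3 T.1 ++ [(1, crossing s), (2, .cup)] := by
        convert (Reduces.exchange hcrossing T.1).1.append [(0, .cap), (2, .cap)] [(2, .cup)]
          using 1 <;> simp [Tangle.beside, Tangle.single]
    _ ↝ [(0, .cap), (2, .cap)] ++ shift 3 T.1 ++ [(2, crossing !s), (1, .cup)] := by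
        convert (Reduces.slide_cup_symm s 1).append ([(0, .cap), (2, .cap)] ++ shift 3 T.1) []
          using 1 <;> simp
    _ ↝ [(0, .cap)] ++ shift 1 T.1 ++ [(0, crossing !s)] ++ [(0, .cap), (1, .cup)] := by
        convert (Reduces.exchange hcap
          ([(0, .cap)] ++ shift 1 T.1 ++ [(0, crossing !s)])).1.append [] [(1, .cup)]
          using 1 <;> simp
    _ ↝ (0, .cap) :: shift 1 T.1 ++ [(0, crossing !s)] := by
        convert (Reduces.zigzag_right 0).append
          ([(0, .cap)] ++ shift 1 T.1 ++ [(0, crossing !s)]) [] using 1 <;> simp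

theorem bendRight_cross {i : ℕ} (hi : i + 2 ≤ m) (s : Bool) (x : TangleClass (n + 1) m) :
    bendRight (cross hi s x) = cross (hi.trans (Nat.le_succ m)) s (bendRight x) := by
  revert x
  exact ind fun T => rfl

theorem bendLeft_cross {i : ℕ} (hi : i + 2 ≤ m) (s : Bool) (x : TangleClass (n + 1) m) :
    bendLeft (cross hi s x) =
      cross (i := 1 + i) (by omega) s (bendLeft x) := by
  revert x
  exact ind fun T => mk_eq_of_reduces (by simpa using Reduces.refl _)

/-- Turn both upper ends down. -/
def bendBoth (x : TangleClass 2 2) : TangleClass 0 4 := bendRight (bendRight x)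

theorem bendBoth_injective : Function.Injective bendBoth :=
  bendRight_injective.comp bendRight_injective

theorem bendBoth_addRight (s : Bool) (x : TangleClass 2 2) :
    bendBoth (addRight s x) = cross (i := 1) (by decide) (!s) (bendBoth x) :=
  (congrArg bendRight (bendRight_addRight s x)).trans (bendRight_cross _ _ _)

theorem bendBoth_addTop (s : Bool) (x : TangleClass 2 2) :
    bendBoth (addTop s x) = cross (i := 2) (by decide) s (bendBoth x) := by
  revert x
  refine ind fun T => (mk_eq_of_reduces ?_).symm
  have hcaps : [(0, .cap), (2, .cap)] ↝ [(0, .cap), (0, .cap)] :=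
    (Reduces.exchange_slices 0 0 .cap .cap).1
  calc [(0, .cap), (1, .cap)] ++ T.1 ++ [(2, crossing s)]
      ↝ [(0, .cap), (1, .cap), (2, crossing s)] ++ T.1 := by
        convert (Reduces.exchange T.2 [(0, crossing s)]).1.append [(0, .cap), (1, .cap)] []
          using 1 <;> simp
    _ ↝ [(0, .cap), (2, .cap), (1, crossing !s)] ++ T.1 := by
        convert (Reduces.slide_cap s 1).append [(0, .cap)] T.1 using 1 <;> simp
    _ ↝ [(0, .cap), (0, .cap), (1, crossing !s)] ++ T.1 := by
        convert hcaps.append [] ((1, crossing !s) :: T.1) using 1 <;> simp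
    _ ↝ [(0, .cap), (1, .cap), (0, crossing s)] ++ T.1 := by
        convert (Reduces.slide_cap (!s) 0).append [(0, .cap)] T.1 using 1 <;> simp

theorem addRight_infty (s : Bool) : addRight s (mk .infty) = mk .infty :=
  bendRight_injective <| (bendRight_addRight s _).trans <|
    mk_eq_of_reduces (Reduces.r1_cap (!s) 1)

theorem addLeft_infty (s : Bool) : addLeft s (mk .infty) = mk .infty :=
  bendLeft_injective <| (bendLeft_addLeft s _).trans <|
    mk_eq_of_reduces (Reduces.r1_cap (!s) 0)

theorem addRight_zero (s : Bool) : addRight s (mk .zero) = mk (.single s) := by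
  refine bendRight_injective <| (bendRight_addRight s _).trans <| mk_eq_of_reduces ?_
  calc [(1, .cap), (0, .cup), (0, .cap), (1, crossing !s)]
      ↝ [(0, .cap), (1, crossing !s)] := (Reduces.zigzag_left 0).append [] _
    _ ↝ [(1, .cap), (0, crossing s)] := by simpa using Reduces.slide_cap (!s) 0

theorem addLeft_zero (s : Bool) : addLeft s (mk .zero) = mk (.single s) := by
  refine bendLeft_injective <| ((bendLeft_addLeft s _).trans <| mk_eq_of_reduces ?_)
  calc [(0, .cap), (1, .cup), (1, .cap), (0, crossing !s)]
      ↝ [(1, .cap), (0, crossing !s)] := (Reduces.zigzag_right 0).append [] _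
    _ ↝ [(0, .cap), (1, crossing s)] := by simpa using Reduces.slide_cap_symm (!s) 0

theorem cross_zero (s : Bool) : cross le_rfl s (mk .zero) = mk .zero :=
  mk_eq_of_reduces ((Reduces.r1_cap s 0).append [(0, .cup)] [])

theorem addTop_zero (s : Bool) : addTop s (mk .zero) = mk .zero :=
  mk_eq_of_reduces ((Reduces.r1_cup s 0).append [] [(0, .cap)])

theorem addRight_addLeft (s t : Bool) (x : TangleClass 2 2) :
    addRight s (addLeft t x) = addLeft t (addRight s x) := by
  revert x
  exact ind fun T => beside_assoc _ T _

theorem addTop_cross (s t : Bool) (x : TangleClass 2 2) :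
    addTop s (cross le_rfl t x) = cross le_rfl t (addTop s x) := by
  revert x
  exact ind fun T => rfl

theorem addRight_addRight_not (s : Bool) (x : TangleClass 2 2) :
    addRight s (addRight (!s) x) = x :=
  bendRight_injective <| by
    rw [bendRight_addRight, bendRight_addRight, cross_cross_not]

theorem addLeft_addLeft_not (s : Bool) (x : TangleClass 2 2) : addLeft s (addLeft (!s) x) = x :=
  bendLeft_injective <| by
    rw [bendLeft_addLeft, bendLeft_addLeft, cross_cross_not]

theorem addTop_addTop_not (s : Bool) (x : TangleClass 2 2) : addTop s (addTop (!s) x) = x :=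
  bendBoth_injective <| by
    rw [bendBoth_addTop, bendBoth_addTop, cross_cross_not]

/-- The addition of `[1]` on the right, with the addition of `[-1]` as its inverse. -/
def right : Equiv.Perm (TangleClass 2 2) := signedPerm addRight addRight_addRight_not

/-- The addition of `[1]` on the left, with the addition of `[-1]` as its inverse. -/
def left : Equiv.Perm (TangleClass 2 2) := signedPerm addLeft addLeft_addLeft_not

/-- The addition of `[1]` at the top, with the addition of `[-1]` as its inverse. -/
def top : Equiv.Perm (TangleClass 2 2) := signedPerm addTop addTop_addTop_not

/-- The addition of `[1]` at the bottom, with the addition of `[-1]` as its inverse. -/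
def bottom : Equiv.Perm (TangleClass 2 2) := braidGen le_rfl

theorem twistPair_right_bottom : TwistPair right bottom (mk .zero) (mk .infty) where
  toFiveBraidPair := (fiveBraidPair_braidGen (i := 0) (by decide)).symm.of_injective
    bendRight_injective (bendRight_addRight false) (bendRight_cross le_rfl true)
  fst_infty := addRight_infty true
  snd_zero := cross_zero true
  one_eq := (addRight_zero true).symm
  negOne_eq := (addRight_zero false).symm

theorem twistPair_left_bottom : TwistPair left bottom (mk .zero) (mk .infty) where
  toFiveBraidPair := (fiveBraidPair_braidGen (i := 0) (by decide)).of_injective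
    bendLeft_injective (bendLeft_addLeft false) (bendLeft_cross le_rfl true)
  fst_infty := addLeft_infty true
  snd_zero := cross_zero true
  one_eq := (addLeft_zero true).symm
  negOne_eq := (addLeft_zero false).symm

theorem twistPair_right_top : TwistPair right top (mk .zero) (mk .infty) where
  toFiveBraidPair := (fiveBraidPair_braidGen (i := 1) (by decide)).of_injective
    bendBoth_injective (bendBoth_addRight false) (bendBoth_addTop true)
  fst_infty := addRight_infty true
  snd_zero := addTop_zero true
  one_eq := (addRight_zero true).symm
  negOne_eq := (addRight_zero false).symm

/-- The classes of the basic tangles, in the order of `Tangle.basic`. -/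
def basicClass : Fin 12 → TangleClass 2 2 := twistOrbit right bottom (mk .zero) (mk .infty)

theorem eqOn_left : Set.EqOn left right (Set.range basicClass) :=
  twistPair_right_bottom.eqOn_fst twistPair_left_bottom
    (Equiv.ext fun x => addRight_addLeft true true x)

theorem eqOn_top : Set.EqOn top bottom (Set.range basicClass) :=
  twistPair_right_bottom.eqOn_snd twistPair_right_top
    (Equiv.ext fun x => (addTop_cross true true x).symm)

theorem mapsTo_right : Set.MapsTo right (Set.range basicClass) (Set.range basicClass) :=
  twistPair_right_bottom.mapsTo_fst

theorem mapsTo_bottom : Set.MapsTo bottom (Set.range basicClass) (Set.range basicClass) :=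
  twistPair_right_bottom.mapsTo_snd

theorem mk_twoFifths : mk Tangle.twoFifths = basicClass 6 := by
  have htwo : basicClass 5 = mk Tangle.two := congrArg (addRight true) (addRight_zero true)
  have htop : top (basicClass 5) = bottom (basicClass 5) := eqOn_top ⟨5, rfl⟩
  calc mk Tangle.twoFifths = top (top (mk Tangle.two)) := rfl
    _ = bottom (bottom (basicClass 5)) := by
        rw [← htwo, htop, eqOn_top (mapsTo_bottom ⟨5, rfl⟩)]

theorem mk_fiveHalves : mk Tangle.fiveHalves = basicClass 7 :=
  calc mk Tangle.fiveHalves = left (left (basicClass 10)) := beside_assoc _ _ _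
    _ = right (right (basicClass 10)) := by
        rw [eqOn_left ⟨10, rfl⟩, eqOn_left (mapsTo_right ⟨10, rfl⟩)]

theorem mk_negThreeHalves : mk Tangle.negThreeHalves = basicClass 9 := by
  have hmaps := mapsTo_of_signedPerm mapsTo_right false
  have hleft : left (addRight false (basicClass 11)) = basicClass 11 :=
    (eqOn_left (hmaps ⟨11, rfl⟩)).trans (addRight_addRight_not true (basicClass 11))
  calc mk Tangle.negThreeHalves = left⁻¹ (basicClass 11) := rfl
    _ = addRight false (basicClass 11) := Equiv.Perm.inv_eq_iff_eq.2 hleft.symm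

theorem mk_basic (i : Fin 12) : mk (Tangle.basic i) = basicClass i := by
  fin_cases i
  exacts [rfl, rfl, (addRight_zero false).symm, (addRight_zero true).symm,
    (congrArg (addRight false) (addRight_zero false)).symm,
    (congrArg (addRight true) (addRight_zero true)).symm, mk_twoFifths, mk_fiveHalves,
    eqOn_left ⟨10, rfl⟩, mk_negThreeHalves, rfl, rfl]

theorem mk_mem_range_basicClass {D : Tangle 2 2} (hD : D.RationalDiagram) :
    mk D ∈ Set.range basicClass := by
  have single {c : Tangle 2 2} (hc : c = .one ∨ c = .negOne) : ∃ s, c = .single s :=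
    hc.elim (fun h => ⟨true, h⟩) fun h => ⟨false, h⟩
  induction hD with
  | zero => exact ⟨1, rfl⟩
  | infty => exact ⟨0, rfl⟩
  | right _ hc ih =>
    obtain ⟨s, rfl⟩ := single hc
    exact mapsTo_of_signedPerm mapsTo_right s ih
  | left _ hc ih =>
    obtain ⟨s, rfl⟩ := single hc
    exact mapsTo_of_signedPerm (mapsTo_right.congr eqOn_left.symm) s ih
  | bottom _ hc ih =>
    obtain ⟨s, rfl⟩ := single hc
    exact mapsTo_of_signedPerm mapsTo_bottom s ih
  | top _ hc ih =>
    obtain ⟨s, rfl⟩ := single hc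
    exact mapsTo_of_signedPerm (mapsTo_bottom.congr eqOn_top.symm) s ih

end TangleClass

theorem lemma2p10 :
    (∀ T : Tangle 2 2, T.IsRational → ∃ i : Fin 12, T.FiveMoveEquiv (Tangle.basic i)) ∧
      (∀ i j : Fin 12, i ≠ j → ¬ (Tangle.basic i).FiveMoveEquiv (Tangle.basic j)) := by
  refine ⟨fun T ⟨D, hD, hTD⟩ => ?_, fun i j hij h => hij (eq_of_fiveMoveEquiv_basic h)⟩
  obtain ⟨i, hi⟩ := TangleClass.mk_mem_range_basicClass hD
  refine ⟨i, TangleClass.mk_eq_mk.1 ?_⟩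
  calc TangleClass.mk T = TangleClass.mk D := TangleClass.mk_eq_mk.2 hTD.fiveMoveEquiv
    _ = TangleClass.mk (Tangle.basic i) := by rw [← hi, TangleClass.mk_basic]
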